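/- Let $N\ge 4$ and $n\ge 0$ be integers and let $S_{\mathrm{off}}\subseteq\{1,\dots,N\}^2$ be a known set of off-diagonal pairs that is symmetric, i.e. $(i,j)\in S_{\mathrm{off}}$ implies $i\ne j$ and $(j,i)\in S_{\mathrm{off}}$. Put $s:=|S_{\mathrm{off}}|$ and assume $4\le s\le N$. Let $E$ be uniformly distributed on the family of symmetric subsets of $S_{\mathrm{off}}$, that is, on $\mathcal E:=\{E'\subseteq S_{\mathrm{off}} : (i,j)\in E'\Rightarrow (j,i)\in E'\}$. Let $Q$ be a (deterministic or random) symmetric $N\times N$ real matrix, independent of $E$, with all entries in $\left[-\frac1{N\log s},\frac1{N\log s}\right]$ (almost surely). Let $H\in\{0,1\}^{N\times N}$ be the matrix with $H_{ij}=1$ iff $(i,j)\in E$, and let $\odot$ denote the entrywise product. Suppose that, given $(E,Q)$, the samples $X_1,\dots,X_n\in\mathbb R^N$ are i.i.d. Gaussian with mean $0$ and precision matrix $I+H\odot Q$, i.e. with covariance matrix $(I+H\odot Q)^{-1}$. Let $S:=E\cup\{(i,i):1\le i\le N\}$. Let $\hat S$ be any estimator of $S$, i.e. any measurable function of $X_1,\dots,X_n$,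 of $Q$, and of auxiliary randomness independent of $(E,Q,X_1,\dots,X_n)$, with values in the subsets of $\{1,\dots,N\}^2$. Then $$\mathbb P\{\hat S\ne S\}\ \ge\ 1-\frac{4n}{(\log 2)(\log s)}-\frac2s .$$ Consequently, if $n\le\frac{\log 2}{8}\log s-\frac{\log 2}{2s}\log s$, then $\mathbb P\{\hat S\ne S\}\ge\frac12$. So $\Omega(\log|S_{\mathrm{off}}|)$ samples are necessary for the novel task: if $s\ge 8$ and $\mathbb P\{\hat S\ne S\}<\frac12$, then $n>\frac{\log 2}{16}\log s$. -/

import Mathlib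

open MeasureTheory ProbabilityTheory
open scoped Matrix

/-- A set of ordered pairs of vertices is a (simple, undirected) edge set if it contains no diagonal
pair and contains `(j, i)` whenever it contains `(i, j)`. -/
def IsEdgeSet {N : ℕ} (S : Finset (Fin N × Fin N)) : Prop :=
  (∀ i j, (i, j) ∈ S → i ≠ j) ∧ (∀ i j, (i, j) ∈ S → (j, i) ∈ S)

/-- The family of all symmetric subsets of `Soff`. -/
def edgeFamily {N : ℕ} (Soff : Finset (Fin N × Fin N)) : Set (Finset (Fin N × Fin N)) :=
  {E | E ⊆ Soff ∧ ∀ i j, (i, j) ∈ E → (j, i) ∈ E}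

/-- The 0-1 matrix `H` of an edge set: `H i j = 1` iff `(i, j) ∈ E`. -/
def edgeMatrix {N : ℕ} (E : Finset (Fin N × Fin N)) : Matrix (Fin N) (Fin N) ℝ :=
  Matrix.of fun i j => if (i, j) ∈ E then 1 else 0

/-- The precision matrix `I + H ⊙ Q`. -/
def precisionMatrix {N : ℕ} (E : Finset (Fin N × Fin N)) (Q : Fin N → Fin N → ℝ) :
    Matrix (Fin N) (Fin N) ℝ :=
  1 + edgeMatrix E ⊙ Matrix.of Q

/-- The law of `n` independent centred Gaussian vectors in `ℝ^N` with covariance matrix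
`(I + H ⊙ Q)⁻¹`. -/
noncomputable def sampleLaw {N : ℕ} (n : ℕ) (E : Finset (Fin N × Fin N))
    (Q : Fin N → Fin N → ℝ) : Measure (Fin n → EuclideanSpace ℝ (Fin N)) :=
  Measure.pi fun _ => multivariateGaussian 0 (precisionMatrix E Q)⁻¹

/-- The support set `E ∪ {(i, i)}`. -/
def supportSet {N : ℕ} (E : Finset (Fin N × Fin N)) : Finset (Fin N × Fin N) :=
  E ∪ Finset.univ.image fun i => (i, i)

/-! Every conditional law of the data is close to one reference law, `n` independent standard
Gaussians, which carries no information on `E`. The perturbation `M = H ⊙ Q` has squared Frobenius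
norm at most `s / (N log s)² ≤ 1 / (N log² s)`, so by Cauchy–Schwarz its eigenvalues `λ i` satisfy
`∑ |λ i| ≤ 1 / log s`. In an eigenbasis the coordinates of a sample are independent `N(0, 1 / (1 + λ
i))`, each within total variation `|λ i|` of `N(0, 1)`. Subadditivity over coordinates and samples
gives distance at most `n / log s` (`hasOverlap_sampleLaw`). Under the reference law, success has
probability at most one over the size of the family, hence at most `2 / s`. So the true success
probability is at most `2 / s + n / log s` (`measure_success_add_le`), which is stronger than the
claim. -/

/-! ### Total variation, expressed through common minorants -/

section Overlap

open scoped ENNReal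

variable {α β : Type*} [MeasurableSpace α] [MeasurableSpace β]

/-- Two measures have overlap at least `c` if they dominate a common measure of total mass at
least `c`. For probability measures this says that their total variation distance is at most
`1 - c`. -/
def HasOverlap (μ ν : Measure α) (c : ℝ≥0∞) : Prop :=
  ∃ η : Measure α, η ≤ μ ∧ η ≤ ν ∧ c ≤ η Set.univ

lemma HasOverlap.mono {μ ν : Measure α} {c c' : ℝ≥0∞} (h : HasOverlap μ ν c) (hc : c' ≤ c) :
    HasOverlap μ ν c' := by
  obtain ⟨η, h1, h2, h3⟩ := h
  exact ⟨η, h1, h2, hc.trans h3⟩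

lemma HasOverlap.map {μ ν : Measure α} {c : ℝ≥0∞} (h : HasOverlap μ ν c) {f : α → β}
    (hf : Measurable f) : HasOverlap (μ.map f) (ν.map f) c := by
  obtain ⟨η, h1, h2, h3⟩ := h
  refine ⟨η.map f, Measure.map_mono h1 hf, Measure.map_mono h2 hf, ?_⟩
  rwa [Measure.map_apply hf MeasurableSet.univ, Set.preimage_univ]

lemma HasOverlap.measure_add_le {μ ν : Measure α} [IsProbabilityMeasure μ] {c : ℝ≥0∞}
    (h : HasOverlap μ ν c) {A : Set α} (hA : MeasurableSet A) : μ A + c ≤ ν A + 1 := by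
  obtain ⟨η, h1, h2, h3⟩ := h
  calc μ A + c ≤ μ A + (η A + η Aᶜ) := by
        rw [measure_add_measure_compl hA]
        gcongr
    _ ≤ μ A + (ν A + μ Aᶜ) := by
        exact add_le_add_right (add_le_add (h2 A) (h1 Aᶜ)) _
    _ = ν A + (μ A + μ Aᶜ) := by ring
    _ = ν A + 1 := by rw [prob_add_prob_compl hA]

variable {ι : Type*} [Fintype ι] {X : ι → Type*} [∀ i, MeasurableSpace (X i)]

/-- The product outer measure is the largest one bounded on boxes by the product of the masses, so
comparing boxes suffices, without σ-finiteness. -/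
lemma measure_pi_mono {μ ν : ∀ i, Measure (X i)} (h : ∀ i, μ i ≤ ν i) :
    Measure.pi μ ≤ Measure.pi ν := by
  refine Measure.le_iff.2 fun s hs => ?_
  rw [Measure.pi, Measure.pi, toMeasure_apply _ _ hs, toMeasure_apply _ _ hs]
  refine OuterMeasure.le_pi.2 (fun t _ => ?_) s
  refine (OuterMeasure.pi_pi_le _ t).trans ?_
  exact Finset.prod_le_prod' fun i _ => h i (t i)

lemma HasOverlap.pi {μ ν : ∀ i, Measure (X i)} [∀ i, IsFiniteMeasure (μ i)] {c : ι → ℝ≥0∞}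
    (h : ∀ i, HasOverlap (μ i) (ν i) (c i)) :
    HasOverlap (Measure.pi μ) (Measure.pi ν) (∏ i, c i) := by
  choose η h1 h2 h3 using h
  have : ∀ i, IsFiniteMeasure (η i) := fun i => isFiniteMeasure_of_le (μ i) (h1 i)
  refine ⟨Measure.pi η, measure_pi_mono h1, measure_pi_mono h2, ?_⟩
  rw [Measure.pi_univ]
  exact Finset.prod_le_prod' fun i _ => h3 i

lemma one_sub_sum_le_prod_one_sub {κ : Type*} (t : Finset κ) {δ : κ → ℝ} (hδ0 : ∀ i, 0 ≤ δ i)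
    (hδ1 : ∀ i, δ i ≤ 1) : 1 - ∑ i ∈ t, δ i ≤ ∏ i ∈ t, (1 - δ i) := by
  classical
  induction t using Finset.induction_on with
  | empty => simp
  | insert a t ha ih =>
    rw [Finset.sum_insert ha, Finset.prod_insert ha]
    have h0 : 0 ≤ ∑ i ∈ t, δ i := Finset.sum_nonneg fun i _ => hδ0 i
    nlinarith [mul_le_mul_of_nonneg_left ih (sub_nonneg.2 (hδ1 a)), mul_nonneg (hδ0 a) h0]

/-- Total variation distance is subadditive over products. -/
lemma HasOverlap.pi_ofReal {μ ν : ∀ i, Measure (X i)} [∀ i, IsFiniteMeasure (μ i)] {δ : ι → ℝ}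
    (hδ0 : ∀ i, 0 ≤ δ i) (hδ1 : ∀ i, δ i ≤ 1)
    (h : ∀ i, HasOverlap (μ i) (ν i) (ENNReal.ofReal (1 - δ i))) :
    HasOverlap (Measure.pi μ) (Measure.pi ν) (ENNReal.ofReal (1 - ∑ i, δ i)) := by
  refine (HasOverlap.pi h).mono ?_
  rw [← ENNReal.ofReal_prod_of_nonneg fun i _ => sub_nonneg.2 (hδ1 i)]
  exact ENNReal.ofReal_le_ofReal (one_sub_sum_le_prod_one_sub _ hδ0 hδ1)

end Overlap

/-! ### Comparison of Gaussian laws -/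

section Gaussian

open scoped ENNReal NNReal

/-- A centred Gaussian density with smaller variance is, after rescaling to the same height at the
origin, dominated by one with larger variance. -/
lemma smul_gaussianReal_le {v w : ℝ≥0} (hv : v ≠ 0) (hvw : v ≤ w) :
    ENNReal.ofReal √(v / w) • gaussianReal 0 v ≤ gaussianReal 0 w := by
  have hv' : (0 : ℝ) < v := by positivity
  have hvw' : (v : ℝ) ≤ w := by exact_mod_cast hvw
  have hw' : (0 : ℝ) < w := hv'.trans_le hvw'
  have hw : w ≠ 0 := by exact_mod_cast hw'.ne'
  rw [gaussianReal_of_var_ne_zero _ hv, gaussianReal_of_var_ne_zero _ hw,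
    ← withDensity_smul _ (measurable_gaussianPDF 0 v)]
  refine withDensity_mono (Filter.Eventually.of_forall fun x => ?_)
  simp only [Pi.smul_apply, smul_eq_mul, gaussianPDF]
  rw [← ENNReal.ofReal_mul (Real.sqrt_nonneg _)]
  refine ENNReal.ofReal_le_ofReal ?_
  simp only [gaussianPDFReal, sub_zero]
  have hc : √(v / w : ℝ) * (√(2 * Real.pi * v))⁻¹ = (√(2 * Real.pi * w))⁻¹ := by
    rw [Real.sqrt_div hv'.le, Real.sqrt_mul (by positivity) (v : ℝ),
      Real.sqrt_mul (by positivity) (w : ℝ)]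
    have h1 : √(v : ℝ) ≠ 0 := by positivity
    have h2 : √(w : ℝ) ≠ 0 := by positivity
    field_simp
  rw [← mul_assoc, hc]
  refine mul_le_mul_of_nonneg_left (Real.exp_le_exp.2 ?_) (by positivity)
  rw [neg_div, neg_div]
  refine neg_le_neg ?_
  gcongr

/-- The common minorant is the narrower density scaled down to fit under the wider one. Its mass is
`√(1 / d) ≥ 1 / d ≥ 2 - d` if `d ≥ 1`, and `√d ≥ d` if `d ≤ 1`. -/
lemma hasOverlap_gaussianReal_inv {d : ℝ} (hd : 0 < d) :
    HasOverlap (gaussianReal 0 d⁻¹.toNNReal) (gaussianReal 0 1)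
      (ENNReal.ofReal (1 - |d - 1|)) := by
  have hd' : (0 : ℝ) < d⁻¹ := by positivity
  have hv : d⁻¹.toNNReal ≠ 0 := by simpa using hd
  rcases le_total 1 d with h | h
  · have hle : d⁻¹.toNNReal ≤ 1 := by
      rw [Real.toNNReal_le_one]
      exact inv_le_one_of_one_le₀ h
    have hr : √(d⁻¹) ≤ 1 := by
      exact Real.sqrt_le_one.2 (inv_le_one_of_one_le₀ h)
    refine ⟨_, ?_, smul_gaussianReal_le hv hle, ?_⟩
    · refine Measure.le_iff.2 fun s _ => ?_
      rw [Measure.smul_apply, smul_eq_mul]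
      refine mul_le_of_le_one_left zero_le ?_
      rw [ENNReal.ofReal_le_one]
      simpa only [NNReal.coe_one, div_one, Real.coe_toNNReal _ hd'.le] using hr
    · simp only [Measure.smul_apply, measure_univ, smul_eq_mul, mul_one, NNReal.coe_one, div_one,
        Real.coe_toNNReal _ hd'.le]
      refine ENNReal.ofReal_le_ofReal ?_
      rw [abs_of_nonneg (sub_nonneg.2 h)]
      refine (?_ : _ ≤ d⁻¹).trans (Real.le_sqrt_of_sq_le ?_)
      · rw [← sub_nonneg]
        have : d⁻¹ - (1 - (d - 1)) = (d - 1) ^ 2 * d⁻¹ := by field_simp; ring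
        rw [this]
        positivity
      · have := inv_le_one_of_one_le₀ h
        nlinarith
  · have hle : 1 ≤ d⁻¹.toNNReal := by
      rw [Real.one_le_toNNReal]
      exact (one_le_inv₀ hd).2 h
    refine ⟨_, smul_gaussianReal_le one_ne_zero hle, ?_, ?_⟩
    · refine Measure.le_iff.2 fun s _ => ?_
      rw [Measure.smul_apply, smul_eq_mul]
      refine mul_le_of_le_one_left zero_le ?_
      rw [ENNReal.ofReal_le_one, NNReal.coe_one, Real.coe_toNNReal _ hd'.le, one_div, inv_inv]
      exact Real.sqrt_le_one.2 h
    · simp only [Measure.smul_apply, measure_univ, smul_eq_mul, mul_one, NNReal.coe_one,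
        Real.coe_toNNReal _ hd'.le, one_div, inv_inv]
      refine ENNReal.ofReal_le_ofReal ?_
      rw [abs_of_nonpos (sub_nonpos.2 h)]
      refine Real.le_sqrt_of_sq_le ?_
      nlinarith

variable {ι : Type*} [Fintype ι]

/-- A centred Gaussian vector whose covariance matrix is diagonal in the orthonormal basis `b` has
independent coordinates in that basis. -/
lemma multivariateGaussian_eq_map_pi [DecidableEq ι] {S : Matrix ι ι ℝ} (hS : S.PosSemidef)
    (b : OrthonormalBasis ι ℝ (EuclideanSpace ℝ ι)) (v : ι → ℝ≥0)
    (h : ∀ x : EuclideanSpace ℝ ι, x ⬝ᵥ S *ᵥ x = ∑ i, v i * (inner ℝ (b i) x) ^ 2) :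
    multivariateGaussian 0 S =
      (Measure.pi fun i => gaussianReal 0 (v i)).map fun x => ∑ i, x i • b i := by
  have hm : Measurable fun x : ι → ℝ => ∑ i, x i • b i := by fun_prop
  have : IsProbabilityMeasure
      ((Measure.pi fun i => gaussianReal 0 (v i)).map fun x => ∑ i, x i • b i) :=
    Measure.isProbabilityMeasure_map hm.aemeasurable
  -- The characteristic function of the image factorises over the coordinates into one-dimensional
  -- Gaussian ones.
  apply Measure.ext_of_charFun
  ext t
  rw [charFun_multivariateGaussian hS, h, charFun_apply, integral_map hm.aemeasurable
    (Measurable.aestronglyMeasurable (by fun_prop))]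
  simp_rw [sum_inner, Complex.ofReal_sum, Finset.sum_mul, Complex.exp_sum,
    integral_fintype_prod_eq_prod
      (f := fun i x => Complex.exp ((inner ℝ (x • b i) t : ℝ) * Complex.I)),
    real_inner_smul_left, mul_comm _ (inner ℝ _ t), Complex.ofReal_mul, ← charFun_apply_real,
    charFun_gaussianReal, ← Complex.exp_sum]
  congr 1
  simp [Finset.sum_div, Finset.sum_neg_distrib]

end Gaussian

/-! ### Gaussian laws with precision matrix near the identity -/

section Perturbation

variable {ι : Type*} [Fintype ι] [DecidableEq ι]

/-- Both sides are the trace of `M * M`. -/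
lemma sum_sq_eigenvalues {M : Matrix ι ι ℝ} (hM : M.IsHermitian) :
    ∑ i, hM.eigenvalues i ^ 2 = ∑ i, ∑ j, M i j ^ 2 := by
  have h1 : M * M = Unitary.conjStarAlgAut ℝ _ hM.eigenvectorUnitary
      (Matrix.diagonal fun i => hM.eigenvalues i ^ 2) := by
    conv_lhs => rw [hM.spectral_theorem]
    rw [← map_mul, Matrix.diagonal_mul_diagonal]
    simp [pow_two]
  have h2 : (M * M).trace = ∑ i, hM.eigenvalues i ^ 2 := by
    rw [h1, Unitary.conjStarAlgAut_apply, Matrix.trace_mul_cycle]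
    simp
  rw [← h2, Matrix.trace]
  refine Finset.sum_congr rfl fun i _ => ?_
  rw [Matrix.diag_apply, Matrix.mul_apply]
  refine Finset.sum_congr rfl fun j _ => ?_
  rw [pow_two, ← hM.apply i j, star_trivial]

/-- A centred Gaussian vector with precision matrix `1 + M`, in an eigenbasis of `M`. -/
lemma multivariateGaussian_inv_one_add {M : Matrix ι ι ℝ} (hM : M.IsHermitian)
    (hpos : ∀ i, 0 < 1 + hM.eigenvalues i) :
    multivariateGaussian 0 (1 + M)⁻¹ =
      (Measure.pi fun i => gaussianReal 0 (1 + hM.eigenvalues i)⁻¹.toNNReal).map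
        fun x => ∑ i, x i • hM.eigenvectorBasis i := by
  set U := hM.eigenvectorUnitary with hU
  have hA : 1 + M = Unitary.conjStarAlgAut ℝ _ U
      (Matrix.diagonal fun i => 1 + hM.eigenvalues i) := by
    conv_lhs => rw [hM.spectral_theorem, ← map_one (Unitary.conjStarAlgAut ℝ _ U)]
    rw [← map_add, ← Matrix.diagonal_one, Matrix.diagonal_add]
    rfl
  have hS : (1 + M)⁻¹ = (U : Matrix ι ι ℝ) *
      Matrix.diagonal (fun i => (1 + hM.eigenvalues i)⁻¹) * (U : Matrix ι ι ℝ)ᴴ := by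
    rw [← Matrix.star_eq_conjTranspose]
    refine Eq.trans ?_ (Unitary.conjStarAlgAut_apply (S := ℝ) U _)
    refine Matrix.inv_eq_right_inv ?_
    rw [hA, ← map_mul, Matrix.diagonal_mul_diagonal]
    simp [fun i => mul_inv_cancel₀ (hpos i).ne']
  refine multivariateGaussian_eq_map_pi ?_ _ _ fun x => ?_
  · rw [hS]
    refine Matrix.PosSemidef.mul_mul_conjTranspose_same ?_ _
    exact Matrix.PosSemidef.diagonal fun i => (inv_pos.2 (hpos i)).le
  · have hUx : ∀ i, ((U : Matrix ι ι ℝ)ᴴ *ᵥ x.ofLp) i = inner ℝ (hM.eigenvectorBasis i) x := by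
      intro i
      simp [Matrix.mulVec, dotProduct, PiLp.inner_apply, hU,
        Matrix.IsHermitian.eigenvectorUnitary_apply, mul_comm]
    rw [hS, ← Matrix.mulVec_mulVec, ← Matrix.mulVec_mulVec, Matrix.dotProduct_mulVec,
      ← Matrix.mulVec_transpose, ← Matrix.conjTranspose_eq_transpose_of_trivial]
    simp only [dotProduct, Matrix.mulVec_diagonal, hUx]
    refine Finset.sum_congr rfl fun i _ => ?_
    rw [Real.coe_toNNReal _ (inv_pos.2 (hpos i)).le]
    ring

/-- The Gaussian law with precision matrix `1 + M` is within total variation distance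
`√N ‖M‖_F` of the standard Gaussian law on `ℝ^N`. -/
lemma hasOverlap_multivariateGaussian_stdGaussian {M : Matrix ι ι ℝ} (hM : M.IsHermitian) {r : ℝ}
    (hr : ∑ i, ∑ j, M i j ^ 2 ≤ r) (hr1 : r < 1) :
    HasOverlap (multivariateGaussian 0 (1 + M)⁻¹) (stdGaussian (EuclideanSpace ℝ ι))
      (ENNReal.ofReal (1 - √(Fintype.card ι * r))) := by
  have hsum := (sum_sq_eigenvalues hM).trans_le hr
  have habs : ∀ i, |hM.eigenvalues i| < 1 := by
    intro i
    rw [← sq_lt_one_iff_abs_lt_one]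
    exact ((Finset.single_le_sum (fun j _ => sq_nonneg (hM.eigenvalues j))
      (Finset.mem_univ i)).trans hsum).trans_lt hr1
  have hpos : ∀ i, 0 < 1 + hM.eigenvalues i := fun i => by
    linarith [(abs_lt.1 (habs i)).1]
  -- By rotation invariance the standard Gaussian can be written in the eigenbasis of `M` too, so
  -- both laws are images of product measures under the same map.
  rw [multivariateGaussian_inv_one_add hM hpos,
    stdGaussian_eq_map_pi_orthonormalBasis hM.eigenvectorBasis]
  refine HasOverlap.map ?_ (by fun_prop)
  refine (HasOverlap.pi_ofReal (δ := fun i => |hM.eigenvalues i|) (fun i => abs_nonneg _)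
    (fun i => (habs i).le) fun i => ?_).mono ?_
  · simpa using hasOverlap_gaussianReal_inv (hpos i)
  · refine ENNReal.ofReal_le_ofReal (sub_le_sub_left (Real.le_sqrt_of_sq_le ?_) _)
    -- Cauchy–Schwarz is the source of the dimension factor.
    refine (sq_sum_le_card_mul_sum_sq).trans ?_
    simp only [sq_abs, Finset.card_univ]
    gcongr

end Perturbation

/-! ### Edge sets and the law of the samples -/

section Graph

variable {N : ℕ}

lemma sum_sq_edgeMatrix_hadamard_le {E Soff : Finset (Fin N × Fin N)} (hE : E ⊆ Soff)
    {Q : Fin N → Fin N → ℝ} {b : ℝ} (hQ : ∀ i j, |Q i j| ≤ b) :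
    ∑ i, ∑ j, (edgeMatrix E ⊙ Matrix.of Q) i j ^ 2 ≤ Soff.card * b ^ 2 := by
  rw [← Fintype.sum_prod_type' (f := fun i j => (edgeMatrix E ⊙ Matrix.of Q) i j ^ 2)]
  have : ∀ p : Fin N × Fin N, (edgeMatrix E ⊙ Matrix.of Q) p.1 p.2 ^ 2 ≤
      if p ∈ Soff then b ^ 2 else 0 := by
    intro p
    simp only [Matrix.hadamard_apply, edgeMatrix, Matrix.of_apply, Prod.mk.eta]
    by_cases hp : p ∈ E
    · simpa [hp, hE hp] using sq_le_sq' (neg_le_of_abs_le (hQ p.1 p.2)) (le_of_abs_le (hQ p.1 p.2))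
    · rw [if_neg hp, zero_mul, zero_pow two_ne_zero]
      split_ifs <;> positivity
  refine (Finset.sum_le_sum fun p _ => this p).trans ?_
  simp

lemma isHermitian_edgeMatrix_hadamard {E : Finset (Fin N × Fin N)}
    (hE : ∀ i j, (i, j) ∈ E → (j, i) ∈ E) {Q : Fin N → Fin N → ℝ} (hQ : ∀ i j, Q i j = Q j i) :
    (edgeMatrix E ⊙ Matrix.of Q).IsHermitian := by
  ext i j
  have : (j, i) ∈ E ↔ (i, j) ∈ E := ⟨hE j i, hE i j⟩
  simp [edgeMatrix, this, hQ j i]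

/-- Members of the family avoid the diagonal, so deleting it recovers `E`. -/
lemma supportSet_injOn_edgeFamily {Soff : Finset (Fin N × Fin N)} (hSoff : IsEdgeSet Soff) :
    Set.InjOn supportSet (edgeFamily Soff) := by
  have key : ∀ E ∈ edgeFamily Soff, ∀ p : Fin N × Fin N, p ∈ E ↔ p ∈ supportSet E ∧ p.1 ≠ p.2 := by
    rintro E hE ⟨i, j⟩
    simp only [supportSet, Finset.mem_union, Finset.mem_image, Finset.mem_univ, true_and,
      Prod.mk.injEq]
    constructor
    · exact fun h => ⟨Or.inl h, hSoff.1 i j (hE.1 h)⟩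
    · rintro ⟨h | ⟨k, rfl, rfl⟩, hne⟩
      · exact h
      · exact absurd rfl hne
  intro E hE E' hE' h
  ext p
  rw [key E hE, key E' hE', h]

/-- Single undirected edges already give half as many members of the family as there are ordered
pairs. -/
lemma card_le_two_mul_ncard_edgeFamily {Soff : Finset (Fin N × Fin N)} (hSoff : IsEdgeSet Soff) :
    Soff.card ≤ 2 * (edgeFamily Soff).ncard := by
  classical
  let f : Fin N × Fin N → Finset (Fin N × Fin N) := fun p => {p, p.swap}
  -- The family has `2 ^ (s / 2)` members, but this linear bound suffices for the term `2 / s`.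
  have h1 : Soff.card ≤ 2 * (Soff.image f).card := by
    refine Finset.card_le_mul_card_image _ 2 fun a ha => ?_
    obtain ⟨p, -, rfl⟩ := Finset.mem_image.1 ha
    refine (Finset.card_le_card (t := {p, p.swap}) fun q hq => ?_).trans Finset.card_le_two
    have hq' : f q = f p := (Finset.mem_filter.1 hq).2
    change q ∈ f p
    rw [← hq']
    simp [f]
  refine h1.trans (Nat.mul_le_mul_left 2 ?_)
  rw [← Set.ncard_coe_finset]
  refine Set.ncard_le_ncard ?_ (Set.toFinite _)
  intro a ha
  obtain ⟨⟨i, j⟩, hp, rfl⟩ := Finset.mem_image.1 (Finset.mem_coe.1 ha)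
  refine ⟨?_, ?_⟩
  · simp only [f, Finset.insert_subset_iff, Finset.singleton_subset_iff]
    exact ⟨hp, hSoff.2 _ _ hp⟩
  · intro k l h
    simp only [f, Prod.swap_prod_mk, Finset.mem_insert, Finset.mem_singleton, Prod.mk.injEq] at h ⊢
    tauto

lemma hasOverlap_sampleLaw {n : ℕ} {Soff E : Finset (Fin N × Fin N)} (hN : 4 ≤ N)
    (hs4 : 4 ≤ Soff.card) (hsN : Soff.card ≤ N) (hE : E ∈ edgeFamily Soff)
    {Q : Fin N → Fin N → ℝ} (hQsymm : ∀ i j, Q i j = Q j i)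
    (hQ : ∀ i j, |Q i j| ≤ 1 / (N * Real.log Soff.card)) :
    HasOverlap (sampleLaw n E Q)
      (Measure.pi fun _ : Fin n => stdGaussian (EuclideanSpace ℝ (Fin N)))
      (ENNReal.ofReal (1 - n / Real.log Soff.card)) := by
  -- Since `4 > e`; this keeps the distance per sample, `1 / log s`, below one.
  have hlog : 1 < Real.log Soff.card := by
    rw [Real.lt_log_iff_exp_lt (by positivity)]
    have : (4 : ℝ) ≤ Soff.card := by exact_mod_cast hs4
    linarith [Real.exp_one_lt_d9]
  have hN' : (4 : ℝ) ≤ N := by exact_mod_cast hN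
  have hsN' : (Soff.card : ℝ) ≤ N := by exact_mod_cast hsN
  set l := Real.log Soff.card
  have hr : (Soff.card : ℝ) * (1 / (N * l)) ^ 2 ≤ 1 / (N * l ^ 2) := by
    calc (Soff.card : ℝ) * (1 / (N * l)) ^ 2 ≤ N * (1 / (N * l)) ^ 2 := by gcongr
      _ = 1 / (N * l ^ 2) := by field_simp
  have h := hasOverlap_multivariateGaussian_stdGaussian
    (isHermitian_edgeMatrix_hadamard hE.2 hQsymm)
    ((sum_sq_edgeMatrix_hadamard_le hE.1 hQ).trans hr)
    (by rw [div_lt_one (by positivity)]; nlinarith)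
  have hsqrt : √(Fintype.card (Fin N) * (1 / (N * l ^ 2))) = 1 / l := by
    rw [Fintype.card_fin, Real.sqrt_eq_iff_mul_self_eq_of_pos (by positivity)]
    field_simp
  rw [hsqrt] at h
  refine (HasOverlap.pi_ofReal (δ := fun _ : Fin n => 1 / l) (fun _ => by positivity)
    (fun _ => ?_) fun _ => h).mono (le_of_eq ?_)
  · rw [div_le_one (by positivity)]
    exact hlog.le
  · simp [div_eq_mul_inv]

end Graph

/-! ### Estimating a uniformly distributed parameter -/

section Estimation

open scoped ENNReal

lemma uniformOn_le_inv_ncard_of_subsingleton {α : Type*} [Finite α] [MeasurableSpace α]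
    [MeasurableSingletonClass α] {F A : Set α} (h : (F ∩ A).Subsingleton) :
    uniformOn F A ≤ (F.ncard : ℝ≥0∞)⁻¹ := by
  rw [uniformOn, cond_apply (Set.toFinite F).measurableSet, Measure.count_apply_finite F F.toFinite,
    ← Set.ncard_eq_toFinset_card]
  refine mul_le_of_le_one_right zero_le ?_
  rw [Measure.count_apply (Set.toFinite _).measurableSet]
  exact_mod_cast Set.encard_le_one_iff_subsingleton.2 h

variable {α β γ δ : Type*} [MeasurableSpace α] [MeasurableSpace β] [MeasurableSpace γ]
  [MeasurableSpace δ] [Finite α] [MeasurableSingletonClass α] [Finite δ]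
  [MeasurableSingletonClass δ]

/-- An estimator that is independent of the uniformly distributed parameter succeeds only by
chance. -/
lemma lintegral_uniformOn_prod_le {F : Set α} [IsProbabilityMeasure (uniformOn F)]
    (ν : Measure β) [IsProbabilityMeasure ν] (R : Measure γ) [IsProbabilityMeasure R]
    {g : α → δ} (hg : Set.InjOn g F) {f : γ × β → δ} (hf : Measurable f) :
    ∫⁻ p, R {x | f (x, p.2) = g p.1} ∂((uniformOn F).prod ν) ≤ (F.ncard : ℝ≥0∞)⁻¹ := by
  have hgm : Measurable g := measurable_of_finite g
  have hm : MeasurableSet {z : (α × β) × γ | f (z.2, z.1.2) = g z.1.1} :=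
    measurableSet_eq_fun (by fun_prop) (by fun_prop)
  have hRm : Measurable fun p : α × β => R {x | f (x, p.2) = g p.1} :=
    measurable_measure_prodMk_left hm
  rw [lintegral_prod_symm' _ hRm]
  refine (lintegral_mono (g := fun _ => (F.ncard : ℝ≥0∞)⁻¹) fun q => ?_).trans (by simp)
  have hq : MeasurableSet {z : α × γ | f (z.2, q) = g z.1} :=
    measurableSet_eq_fun (by fun_prop) (by fun_prop)
  refine (Measure.prod_apply (μ := uniformOn F) (ν := R) hq).symm.trans_le ?_
  -- With `q` and the sample `x` both fixed, the estimate is a single value, matched by at most one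
  -- parameter in `F`.
  rw [Measure.prod_apply_symm hq]
  refine (lintegral_mono (g := fun _ => (F.ncard : ℝ≥0∞)⁻¹) fun x => ?_).trans (by simp)
  refine uniformOn_le_inv_ncard_of_subsingleton ?_
  rintro a ⟨ha, ha'⟩ b ⟨hb, hb'⟩
  exact hg ha hb (Eq.trans (Eq.symm ha') hb')

/-- If all conditional laws of the sample overlap with one fixed law, an estimator of a uniformly
distributed parameter does little better than chance. -/
lemma compProd_success_add_le {F : Set α} [IsProbabilityMeasure (uniformOn F)]
    (ν : Measure β) [IsProbabilityMeasure ν] (R : Measure γ) [IsProbabilityMeasure R]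
    (κ : Kernel (α × β) γ) [IsMarkovKernel κ] {c : ℝ≥0∞}
    (hκ : ∀ᵐ p ∂((uniformOn F).prod ν), HasOverlap (κ p) R c)
    {g : α → δ} (hg : Set.InjOn g F) {f : γ × β → δ} (hf : Measurable f) :
    (((uniformOn F).prod ν) ⊗ₘ κ) {z | f (z.2, z.1.2) = g z.1.1} + c ≤
      (F.ncard : ℝ≥0∞)⁻¹ + 1 := by
  have hgm : Measurable g := measurable_of_finite g
  have hm : MeasurableSet {z : (α × β) × γ | f (z.2, z.1.2) = g z.1.1} :=
    measurableSet_eq_fun (by fun_prop) (by fun_prop)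
  set ρ := (uniformOn F).prod ν
  calc (ρ ⊗ₘ κ) {z | f (z.2, z.1.2) = g z.1.1} + c
      = ∫⁻ p, (κ p {x | f (x, p.2) = g p.1} + c) ∂ρ := by
        rw [Measure.compProd_apply hm, lintegral_add_right _ measurable_const]
        simp
    _ ≤ ∫⁻ p, (R {x | f (x, p.2) = g p.1} + 1) ∂ρ := by
        refine lintegral_mono_ae ?_
        filter_upwards [hκ] with p hp
        exact hp.measure_add_le (measurable_prodMk_left hm)
    _ ≤ (F.ncard : ℝ≥0∞)⁻¹ + 1 := by
        rw [lintegral_add_right _ measurable_const]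
        simp only [lintegral_const, measure_univ, mul_one]
        gcongr
        exact lintegral_uniformOn_prod_le ν R hg hf

end Estimation

/-! ### Removing the auxiliary randomness -/

section FailureProbability

open scoped ENNReal

/-- By independence one may fix the value `u` of `U`; each `u` gives a deterministic estimator, and
the bound is then averaged over `u`. -/
lemma measure_success_add_le {Ω 𝒰 α β γ δ : Type*} [MeasurableSpace Ω] [MeasurableSpace 𝒰]
    [MeasurableSpace α] [MeasurableSpace β] [MeasurableSpace γ] [MeasurableSpace δ]
    [Finite α] [MeasurableSingletonClass α] [Finite δ] [MeasurableSingletonClass δ]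
    [StandardBorelSpace γ] [Nonempty γ]
    (P : Measure Ω) [IsProbabilityMeasure P] {E : Ω → α} (hE : Measurable E)
    {Q : Ω → β} (hQ : Measurable Q) {X : Ω → γ} (hX : Measurable X)
    {U : Ω → 𝒰} (hU : Measurable U) {F : Set α} (hEunif : P.map E = uniformOn F)
    (hEQ : IndepFun E Q P) (R : Measure γ) [IsProbabilityMeasure R] {c : ℝ≥0∞}
    (hκ : ∀ᵐ p ∂(P.map fun ω => (E ω, Q ω)),
      HasOverlap (condDistrib X (fun ω => (E ω, Q ω)) P p) R c)
    (hUindep : IndepFun (fun ω => (E ω, Q ω, X ω)) U P)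
    {g : α → δ} (hg : Set.InjOn g F) {f : γ × β × 𝒰 → δ} (hf : Measurable f) :
    P {ω | f (X ω, Q ω, U ω) = g (E ω)} + c ≤ (F.ncard : ℝ≥0∞)⁻¹ + 1 := by
  have hgm : Measurable g := measurable_of_finite g
  have hprobF : IsProbabilityMeasure (uniformOn F) :=
    hEunif ▸ Measure.isProbabilityMeasure_map hE.aemeasurable
  have hprobQ : IsProbabilityMeasure (P.map Q) := Measure.isProbabilityMeasure_map hQ.aemeasurable
  have hprobU : IsProbabilityMeasure (P.map U) := Measure.isProbabilityMeasure_map hU.aemeasurable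
  have hρ : P.map (fun ω => (E ω, Q ω)) = (uniformOn F).prod (P.map Q) := by
    rw [← hEunif]
    exact (indepFun_iff_map_prod_eq_prod_map_map hE.aemeasurable hQ.aemeasurable).1 hEQ
  have hXU : IndepFun (fun ω => ((E ω, Q ω), X ω)) U P :=
    hUindep.comp (φ := fun z : α × β × γ => ((z.1, z.2.1), z.2.2)) (ψ := id)
      (by fun_prop) measurable_id
  have hjoint : P.map (fun ω => (((E ω, Q ω), X ω), U ω)) =
      (((uniformOn F).prod (P.map Q)) ⊗ₘ condDistrib X (fun ω => (E ω, Q ω)) P).prod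
        (P.map U) := by
    rw [(indepFun_iff_map_prod_eq_prod_map_map (by fun_prop) hU.aemeasurable).1 hXU, ← hρ,
      compProd_map_condDistrib hX.aemeasurable]
  rw [hρ] at hκ
  have hm : MeasurableSet
      {z : ((α × β) × γ) × 𝒰 | f (z.1.2, z.1.1.2, z.2) = g z.1.1.1} :=
    measurableSet_eq_fun (by fun_prop) (by fun_prop)
  have hP : P {ω | f (X ω, Q ω, U ω) = g (E ω)} =
      P.map (fun ω => (((E ω, Q ω), X ω), U ω))
        {z | f (z.1.2, z.1.1.2, z.2) = g z.1.1.1} := by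
    rw [Measure.map_apply (by fun_prop) hm]
    rfl
  rw [hP, hjoint, Measure.prod_apply_symm hm]
  calc _ = ∫⁻ u, ((((uniformOn F).prod (P.map Q)) ⊗ₘ condDistrib X (fun ω => (E ω, Q ω)) P)
          {z | f (z.2, z.1.2, u) = g z.1.1} + c) ∂(P.map U) := by
        rw [lintegral_add_right _ measurable_const]
        simp
    _ ≤ ∫⁻ _, ((F.ncard : ℝ≥0∞)⁻¹ + 1) ∂(P.map U) := by
        refine lintegral_mono fun u => ?_
        exact compProd_success_add_le (P.map Q) R _ hκ hg
          (f := fun y : γ × β => f (y.1, y.2, u)) (by fun_prop)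
    _ = _ := by simp

end FailureProbability

/-! ### The sample complexity bound -/

theorem theorem5
    {N n s : ℕ} (hN : 4 ≤ N)
    -- the known edge set and its size
    (Soff : Finset (Fin N × Fin N)) (hSoff : IsEdgeSet Soff)
    (hs : Soff.card = s) (hs4 : 4 ≤ s) (hsN : s ≤ N)
    -- the probability space, the random edge set `E`, the matrix `Q`, the samples `X`,
    -- and auxiliary randomness `U` of the estimator
    {Ω : Type*} [MeasurableSpace Ω] (P : Measure Ω) [IsProbabilityMeasure P]
    {𝒰 : Type*} [MeasurableSpace 𝒰]
    (E : Ω → Finset (Fin N × Fin N)) (hE : Measurable E)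
    (Q : Ω → Fin N → Fin N → ℝ) (hQ : Measurable Q)
    (X : Ω → Fin n → EuclideanSpace ℝ (Fin N)) (hX : Measurable X)
    (U : Ω → 𝒰) (hU : Measurable U)
    -- `E` is uniform on the symmetric subsets of `Soff`, whatever the value of `Q`
    (hEunif : P.map E = uniformOn (edgeFamily Soff))
    (hEQ : IndepFun E Q P)
    -- `Q` is symmetric with entries bounded by `1 / (N log s)`
    (hQsymm : ∀ᵐ ω ∂P, ∀ i j, Q ω i j = Q ω j i)
    (hQbound : ∀ᵐ ω ∂P, ∀ i j, |Q ω i j| ≤ 1 / (N * Real.log s))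
    -- given `(E, Q)`, the samples are i.i.d. `N(0, (I + H ⊙ Q)⁻¹)`
    (hXlaw : ∀ᵐ p ∂(P.map fun ω => (E ω, Q ω)),
      condDistrib X (fun ω => (E ω, Q ω)) P p = sampleLaw n p.1 p.2)
    -- the auxiliary randomness is independent of everything else
    (hUindep : IndepFun (fun ω => (E ω, Q ω, X ω)) U P)
    -- the estimator, which may use the samples, the matrix `Q` and the auxiliary randomness
    (Shat : (Fin n → EuclideanSpace ℝ (Fin N)) × (Fin N → Fin N → ℝ) × 𝒰 →
      Finset (Fin N × Fin N))
    (hShat : Measurable Shat) :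
    -- the lower bound for the failure probability
    P.real {ω | Shat (X ω, Q ω, U ω) ≠ supportSet (E ω)}
        ≥ 1 - 4 * n / (Real.log 2 * Real.log s) - 2 / s ∧
    -- too few samples: failure probability at least one half
    ((n : ℝ) ≤ Real.log 2 / 8 * Real.log s - Real.log 2 / (2 * s) * Real.log s →
      1 / 2 ≤ P.real {ω | Shat (X ω, Q ω, U ω) ≠ supportSet (E ω)}) ∧
    -- hence order `log s` samples are necessary, with an absolute constant
    (8 ≤ s → P.real {ω | Shat (X ω, Q ω, U ω) ≠ supportSet (E ω)} < 1 / 2 →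
      Real.log 2 / 16 * Real.log s < n) := by
  have hfail : 1 - 4 * n / (Real.log 2 * Real.log s) - 2 / s ≤
      P.real {ω | Shat (X ω, Q ω, U ω) ≠ supportSet (E ω)} := by
    subst hs
    have hs0 : (4 : ℝ) ≤ Soff.card := by exact_mod_cast hs4
    have hlog : 0 < Real.log Soff.card := Real.log_pos (by linarith)
    have hmem : ∀ᵐ ω ∂P, E ω ∈ edgeFamily Soff := by
      have h : ∀ᵐ e ∂(P.map E), e ∈ edgeFamily Soff := by
        rw [hEunif, uniformOn]
        exact ae_cond_mem (Set.toFinite _).measurableSet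
      exact ae_of_ae_map hE.aemeasurable h
    have hEQm : Measurable fun ω => (E ω, Q ω) := hE.prodMk hQ
    have hoverlap : ∀ᵐ p ∂(P.map fun ω => (E ω, Q ω)),
        HasOverlap (condDistrib X (fun ω => (E ω, Q ω)) P p)
          (Measure.pi fun _ : Fin n => stdGaussian (EuclideanSpace ℝ (Fin N)))
          (ENNReal.ofReal (1 - n / Real.log Soff.card)) := by
      have hgood : ∀ᵐ p ∂(P.map fun ω => (E ω, Q ω)), p.1 ∈ edgeFamily Soff ∧
          (∀ i j, p.2 i j = p.2 j i) ∧
            ∀ i j, |p.2 i j| ≤ 1 / (N * Real.log Soff.card) := by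
        refine (ae_map_iff hEQm.aemeasurable ?_).2 ?_
        · have h1 : MeasurableSet {q : Fin N → Fin N → ℝ | ∀ i j, q i j = q j i} := by
            simp only [Set.ofPred_forall]
            exact .iInter fun i => .iInter fun j =>
              measurableSet_eq_fun (by fun_prop) (by fun_prop)
          have h2 : MeasurableSet {q : Fin N → Fin N → ℝ |
              ∀ i j, |q i j| ≤ 1 / (N * Real.log Soff.card)} := by
            simp only [Set.ofPred_forall]
            exact .iInter fun i => .iInter fun j =>
              measurableSet_le (by fun_prop) measurable_const
          exact (Set.toFinite (edgeFamily Soff)).measurableSet.prod (h1.inter h2)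
        · filter_upwards [hmem, hQsymm, hQbound] with ω h1 h2 h3 using ⟨h1, h2, h3⟩
      filter_upwards [hgood, hXlaw] with p hp hlaw
      rw [hlaw]
      exact hasOverlap_sampleLaw hN hs4 hsN hp.1 hp.2.1 hp.2.2
    have hsucc := measure_success_add_le P hE hQ hX hU hEunif hEQ _ hoverlap hUindep
      (supportSet_injOn_edgeFamily hSoff) hShat
    set T := {ω | Shat (X ω, Q ω, U ω) = supportSet (E ω)} with hT
    have hTm : MeasurableSet T :=
      measurableSet_eq_fun (hShat.comp (hX.prodMk (hQ.prodMk hU)))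
        ((measurable_of_finite supportSet).comp hE)
    have hcompl : P.real {ω | Shat (X ω, Q ω, U ω) ≠ supportSet (E ω)} = 1 - P.real T :=
      probReal_compl_eq_one_sub hTm
    have hcard : (Soff.card : ℝ) ≤ 2 * (edgeFamily Soff).ncard := by
      exact_mod_cast card_le_two_mul_ncard_edgeFamily hSoff
    have hM : (0 : ℝ) < (edgeFamily Soff).ncard := by linarith
    have hreal : P.real T + (1 - n / Real.log Soff.card) ≤
        ((edgeFamily Soff).ncard : ℝ)⁻¹ + 1 := by
      have htop : ((edgeFamily Soff).ncard : ENNReal)⁻¹ ≠ ⊤ := by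
        refine ENNReal.inv_ne_top.2 ?_
        exact_mod_cast hM.ne'
      have h := ENNReal.toReal_mono (by finiteness) hsucc
      rw [ENNReal.toReal_add (by finiteness) (by finiteness),
        ENNReal.toReal_add htop (by finiteness), ENNReal.toReal_inv] at h
      simp only [ENNReal.toReal_natCast, ENNReal.toReal_one] at h
      refine le_trans ?_ h
      -- `ENNReal.ofReal` truncates `1 - n / log s` at zero, which only strengthens the inequality.
      rw [ENNReal.toReal_ofReal']
      exact add_le_add_right (le_max_left _ _) _
    have hinv : ((edgeFamily Soff).ncard : ℝ)⁻¹ ≤ 2 / Soff.card := by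
      rw [inv_le_comm₀ hM (by positivity), inv_div]
      linarith
    -- The argument yields constant `1`; the stated `4 / log 2` is larger.
    have hn : n / Real.log Soff.card ≤ 4 * n / (Real.log 2 * Real.log Soff.card) := by
      rw [div_le_div_iff₀ hlog (by positivity)]
      have h2 : Real.log 2 ≤ 4 := by linarith [Real.log_two_lt_d9]
      have : 0 ≤ (n : ℝ) * Real.log Soff.card := by positivity
      nlinarith
    rw [hcompl]
    linarith
  have hs0 : (4 : ℝ) ≤ s := by exact_mod_cast hs4
  have hlog : 0 < Real.log s := Real.log_pos (by linarith)
  have hlog2 : 0 < Real.log 2 := Real.log_pos one_lt_two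
  have hhalf : (n : ℝ) ≤ Real.log 2 / 8 * Real.log s - Real.log 2 / (2 * s) * Real.log s →
      1 / 2 ≤ P.real {ω | Shat (X ω, Q ω, U ω) ≠ supportSet (E ω)} := by
    intro hn
    refine le_trans ?_ hfail
    have h : 4 * n / (Real.log 2 * Real.log s) ≤ 1 / 2 - 2 / s := by
      rw [div_le_iff₀ (by positivity)]
      have e : (1 / 2 - 2 / (s : ℝ)) * (Real.log 2 * Real.log s) =
          4 * (Real.log 2 / 8 * Real.log s - Real.log 2 / (2 * s) * Real.log s) := by
        field_simp
        ring
      rw [e]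
      linarith
    linarith
  refine ⟨hfail, hhalf, fun hs8 hlt => ?_⟩
  by_contra! hn
  refine hlt.not_ge (hhalf (hn.trans ?_))
  have hs8' : (8 : ℝ) ≤ s := by exact_mod_cast hs8
  -- For `s ≥ 8` the correction uses up at most half of `log 2 / 8`, which leaves `log 2 / 16`.
  have h : Real.log 2 / (2 * s) ≤ Real.log 2 / 16 := by
    gcongr
    linarith
  nlinarith
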